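/- Let $X$ be a locally compact Polish space with Borel $\sigma$-algebra $\mathcal B(X)$, let $\mathscr P$ be the space of Borel probability measures on $X$, and let $\sigma\in\mathscr P$ be diffuse (i.e. $\sigma(\{x\})=0$ for all $x\in X$). For bounded measurable $g\colon X\to\mathbb R$ and $\eta\in\mathscr P$ write $\langle g,\eta\rangle=\int_X g\,d\eta$. Let $\mathcal D_\sigma$ be the Dirichlet–Ferguson measure with intensity $\sigma$, i.e. the unique probability measure on $\mathscr P$ such that (i) for each $B\in\mathcal B(X)$ with $\sigma(B)=0$ one has $\eta(B)=0$ for $\mathcal D_\sigma$-a.a. $\eta$; and (ii) for each $k\ge 2$ and each ordered partition $(X_1,\dots,X_k)$ of $X$ into Borel sets with $\alpha_i:=\sigma(X_i)>0$, the image of $\mathcal D_\sigma$ under $\eta\mapsto(\eta(X_1),\dots,\eta(X_k))$ is the Dirichlet distribution with parameter $(\alpha_1,\dots,\alpha_k)$, i.e. the probability measure on the simplex $\{y\in[0,\infty)^k : y_1+\dots+y_k=1\}$ with density $\frac{\Gamma(\alpha_1+\dots+\alpha_k)}{\Gamma(\alpha_1)\cdots\Gamma(\alpha_k)}\prod_{i=1}^k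 y_i^{\alpha_i-1}$ with respect to $dy_1\cdots dy_{k-1}$, where $y_k=1-y_1-\dots-y_{k-1}$. Then for every integer $n\ge 1$ and all bounded measurable functions $g_1,\dots,g_n\colon X\to\mathbb R$, the function $\eta\mapsto\prod_{i=1}^n\langle g_i,\eta\rangle$ is $\mathcal D_\sigma$-integrable and $$\int_{\mathscr P}\prod_{i=1}^n\langle g_i,\eta\rangle\,d\mathcal D_\sigma(\eta)=\frac1n\sum_{\substack{\xi\subset\{1,\dots,n\}\\ |\xi|<n}}\binom{n}{|\xi|}^{-1}\int_{\mathscr P}\prod_{i\in\xi}\langle g_i,\eta\rangle\,d\mathcal D_\sigma(\eta)\int_X\prod_{j\in\{1,\dots,n\}\setminus\xi}g_j\,d\sigma .$$ In particular, for every integer $n\ge1$ and every bounded measurable $g\colon X\to\mathbb R$, $$\int_{\mathscr P}\langle g,\eta\rangle^n\,d\mathcal D_\sigma(\eta)=\frac1n\sum_{i=0}^{n-1}\int_{\mathscr P}\langle g,\eta\rangle^i\,d\mathcal D_\sigma(\eta)\int_X g^{\,n-i}\,d\sigma .$$ -/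

import Mathlib

open MeasureTheory

/-- The multivariate Beta function `∏ Γ(αᵢ) / Γ(∑ αᵢ)`. -/
noncomputable def multiBeta {k : ℕ} (α : Fin k → ℝ) : ℝ :=
  (∏ i, Real.Gamma (α i)) / Real.Gamma (∑ i, α i)

/-- Completes `(y₁, …, yₘ)` by the last coordinate `1 - y₁ - ⋯ - yₘ`. -/
def simplexPoint {m : ℕ} (y : Fin m → ℝ) : Fin (m + 1) → ℝ :=
  Fin.snoc (α := fun _ => ℝ) y (1 - ∑ i, y i)

/-- The Dirichlet distribution with parameter `α` in `k = m + 1` variables, as a measure on `ℝᵏ`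
carried by the standard closed simplex: the law whose first `m` coordinates have, with respect to
Lebesgue measure on `ℝᵐ`, the density `B(α)⁻¹ ∏ yᵢ ^ (αᵢ - 1)` on the set of points for which
`(y₁, …, yₘ, 1 - y₁ - ⋯ - yₘ)` lies in the simplex. -/
noncomputable def dirichletDistribution {m : ℕ} (α : Fin (m + 1) → ℝ) :
    Measure (Fin (m + 1) → ℝ) :=
  ((volume.restrict {y : Fin m → ℝ | simplexPoint y ∈ stdSimplex ℝ (Fin (m + 1))}).withDensity
    (fun y => ENNReal.ofReal
      ((1 / multiBeta α) * ∏ i, simplexPoint y i ^ (α i - 1)))).map simplexPoint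

/-- `𝒟` is the Dirichlet–Ferguson measure with intensity `σ`: the law of a random probability
measure `η` over `X` such that `η` almost surely does not charge a given `σ`-null set, and such that
for each ordered measurable partition of `X` into `k = m + 1 ≥ 2` sets of positive `σ`-measure
the random vector of the `η`-measures of its cells has the Dirichlet distribution with
parameters the `σ`-measures of the cells. -/
structure IsDirichletFerguson {X : Type*} [MeasurableSpace X] (σ : Measure X)
    (𝒟 : Measure (ProbabilityMeasure X)) : Prop where
  isProbabilityMeasure : IsProbabilityMeasure 𝒟
  null : ∀ B : Set X, MeasurableSet B → σ B = 0 →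
    ∀ᵐ η : ProbabilityMeasure X ∂𝒟, (η : Measure X) B = 0
  map_eval : ∀ m : ℕ, 1 ≤ m → ∀ P : Fin (m + 1) → Set X,
    (∀ i, MeasurableSet (P i)) → Pairwise (fun i j => Disjoint (P i) (P j)) →
    (⋃ i, P i) = Set.univ → (∀ i, 0 < σ (P i)) →
    𝒟.map (fun (η : ProbabilityMeasure X) i => (η : Measure X).real (P i)) =
      dirichletDistribution (fun i => σ.real (P i))

/-!
The recursion is linear in each `g i` and stable under bounded pointwise limits, so it is enough to
prove it when all the `g i` factor through one measurable map `π` into a finite type, and there,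
after expanding, when `g i` is the indicator of the cell `π ⁻¹' {f i}`.

For such indicators, the moments are those of a Dirichlet vector. With `α v = σ (π ⁻¹' {v})`,
`IsDirichletFerguson.integral_prod_pow` gives
`E ∏ v, η (π ⁻¹' {v}) ^ k v = (∏ v, α v (α v + 1) ⋯ (α v + k v - 1)) / (∑ v, k v)!`, where null
cells are allowed. This rests on the Dirichlet integral `lintegral_prod_fracKernel`: the kernels
`x ^ (a - 1) / Γ(a)` on the half-line form a convolution semigroup in `a`.

What remains is the identity `sum_inv_choose_mul_urnWeight` between products of rising factorials.
In its sum over `ξ`, the factor `∫ ∏ j ∈ ξᶜ, g j ∂σ` vanishes unless `ξᶜ` lies in one fibre of `f`;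
summing over the subsets of a fibre of size `N` by their size `s` leaves
`∑ s ∈ [1, N], N (N - 1) ⋯ (N - s + 1) · a · a⁽ᴺ⁻ˢ⁾ = N · a⁽ᴺ⁾`, with `a⁽ᵏ⁾` the rising factorial
(`sum_descFactorial_mul_ascPochhammer`), and the fibre sizes add up to `n`.

To treat both kinds of integrals in one go, each product
`(∫ ∏ i ∈ ξ, ⟨g i, η⟩ ∂𝒟) * ∫ ∏ j ∈ ξᶜ, g j ∂σ` is handled as one integral over
`𝒟.prod σ`, called `mixedMoment`.
-/

/-! ### The Dirichlet integral -/

/-- The Riemann–Liouville kernel `x ^ (a - 1) / Γ(a)` on the closed half-line `0 ≤ x`, extended by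
`0`. The point `0` is included so that the kernel matches the closed simplex. -/
noncomputable def fracKernel (a x : ℝ) : ENNReal :=
  ENNReal.ofReal (if 0 ≤ x then x ^ (a - 1) / Real.Gamma a else 0)

@[fun_prop]
lemma measurable_fracKernel (a : ℝ) : Measurable (fracKernel a) := by
  unfold fracKernel
  exact ENNReal.measurable_ofReal.comp
    (Measurable.ite measurableSet_Ici (by fun_prop) measurable_const)

lemma fracKernel_of_neg {a x : ℝ} (hx : x < 0) : fracKernel a x = 0 := by
  simp [fracKernel, hx.not_ge]

lemma lintegral_comp_inv_mul {t : ℝ} (ht : 0 < t) {f : ℝ → ENNReal} (hf : Measurable f) :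
    ∫⁻ x, f (t⁻¹ * x) = ENNReal.ofReal t * ∫⁻ x, f x := by
  rw [← lintegral_map hf (by fun_prop), Real.map_volume_mul_left (inv_ne_zero ht.ne'),
    lintegral_smul_measure, inv_inv, abs_of_pos ht, smul_eq_mul]

/-- The kernels form a convolution semigroup, which is the Beta integral. At `t = 0` the identity
can fail: for `a + b = 1` the right side is `0 ^ 0 / Γ(1) = 1`. -/
lemma lintegral_fracKernel_mul_fracKernel {a b t : ℝ} (ha : 0 < a) (hb : 0 < b) (ht : t ≠ 0) :
    ∫⁻ x, fracKernel a x * fracKernel b (t - x) = fracKernel (a + b) t := by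
  rcases ht.lt_or_gt with ht | ht
  · rw [fracKernel_of_neg ht]
    refine (lintegral_congr fun x => ?_).trans lintegral_zero
    rcases lt_or_ge x 0 with hx | hx
    · rw [fracKernel_of_neg hx, zero_mul]
    · rw [fracKernel_of_neg (by linarith : t - x < 0), mul_zero]
  have hae : ∀ᵐ x : ℝ, x ≠ 0 ∧ x ≠ t := by
    filter_upwards [Measure.ae_ne volume (0 : ℝ), Measure.ae_ne volume t] with x h1 h2
    exact ⟨h1, h2⟩
  have hm : Measurable (ProbabilityTheory.betaPDF a b) :=
    ENNReal.measurable_ofReal.comp (ProbabilityTheory.measurable_betaPDFReal a b)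
  have hΓ := Real.Gamma_pos_of_pos (add_pos ha hb)
  have hΓa := Real.Gamma_pos_of_pos ha
  have hΓb := Real.Gamma_pos_of_pos hb
  -- The substitution `x = t * u` turns the integrand into a multiple of the Beta density in `u`;
  -- the endpoints `0` and `t` are excluded there.
  calc ∫⁻ x, fracKernel a x * fracKernel b (t - x)
      = ∫⁻ x, fracKernel (a + b) t * (ENNReal.ofReal t⁻¹ *
          ProbabilityTheory.betaPDF a b (t⁻¹ * x)) := by
        refine lintegral_congr_ae (hae.mono fun x hx => ?_)
        rcases hx.1.lt_or_gt with h0 | h0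
        · simp only
          rw [fracKernel_of_neg h0, ProbabilityTheory.betaPDF_eq_zero_of_nonpos
            (mul_nonpos_of_nonneg_of_nonpos (by positivity) h0.le)]
          simp
        rcases hx.2.lt_or_gt with h1 | h1
        · have h1' : 0 < t - x := by linarith
          have h2 : t⁻¹ * x < 1 := by rw [inv_mul_lt_iff₀ ht]; linarith
          simp only
          rw [ProbabilityTheory.betaPDF_of_pos_lt_one (by positivity) h2]
          simp only [fracKernel, h0.le, h1'.le, ht.le, if_true]
          rw [← ENNReal.ofReal_mul (by positivity), ← ENNReal.ofReal_mul (by positivity),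
            ← ENNReal.ofReal_mul (by positivity)]
          congr 1
          have e1 : 1 - t⁻¹ * x = t⁻¹ * (t - x) := by field_simp
          rw [e1, Real.mul_rpow (by positivity) h0.le, Real.mul_rpow (by positivity) h1'.le,
            Real.inv_rpow ht.le, Real.inv_rpow ht.le, ProbabilityTheory.beta,
            show a + b - 1 = (a - 1) + (b - 1) + 1 by ring, Real.rpow_add ht, Real.rpow_add ht,
            Real.rpow_one]
          have p1 := Real.rpow_pos_of_pos ht (a - 1)
          have p2 := Real.rpow_pos_of_pos ht (b - 1)
          field_simp
        · simp only
          rw [fracKernel_of_neg (by linarith : t - x < 0),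
            ProbabilityTheory.betaPDF_eq_zero_of_one_le]
          · simp
          · rw [le_inv_mul_iff₀ ht]; linarith
    _ = fracKernel (a + b) t := by
        rw [lintegral_const_mul _ (by fun_prop), lintegral_const_mul _ (by fun_prop),
          lintegral_comp_inv_mul ht hm, ProbabilityTheory.lintegral_betaPDF_eq_one ha hb, mul_one,
          ← ENNReal.ofReal_mul (by positivity), inv_mul_cancel₀ ht.ne', ENNReal.ofReal_one, mul_one]

/-- The Dirichlet integral over the simplex of size `t`, as an iterated convolution. -/
lemma lintegral_prod_fracKernel {m : ℕ} (a : Fin (m + 1) → ℝ) (ha : ∀ i, 0 < a i) {t : ℝ}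
    (ht : t ≠ 0) :
    ∫⁻ y : Fin m → ℝ, (∏ i, fracKernel (a i.castSucc) (y i)) *
      fracKernel (a (Fin.last m)) (t - ∑ i, y i) = fracKernel (∑ i, a i) t := by
  induction m generalizing t with
  | zero => simp [volume_pi]
  | succ m ih =>
    have hs : 0 < ∑ i : Fin (m + 1), a i.succ :=
      Finset.sum_pos (fun i _ => ha _) Finset.univ_nonempty
    rw [Fin.sum_univ_succ, ← lintegral_fracKernel_mul_fracKernel (ha 0) hs ht,
      ← (volume_preserving_piFinSuccAbove (fun _ : Fin (m + 1) => ℝ) 0).symm.lintegral_comp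
        (by fun_prop), Measure.volume_eq_prod, lintegral_prod _ (by fun_prop)]
    refine lintegral_congr_ae ((Measure.ae_ne volume t).mono fun x hx => ?_)
    have hcons : ∀ y : Fin m → ℝ, (MeasurableEquiv.piFinSuccAbove (fun _ : Fin (m + 1) => ℝ) 0).symm
        (x, y) = (Fin.cons x y : Fin (m + 1) → ℝ) :=
      fun y => Fin.insertNth_zero' x y
    have hint : ∀ y : Fin m → ℝ,
        (∏ i, fracKernel (a i.castSucc) ((Fin.cons x y : Fin (m + 1) → ℝ) i)) *
          fracKernel (a (Fin.last (m + 1))) (t - ∑ i, (Fin.cons x y : Fin (m + 1) → ℝ) i) =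
        fracKernel (a 0) x * ((∏ i : Fin m, fracKernel (a i.castSucc.succ) (y i)) *
          fracKernel (a (Fin.last m).succ) (t - x - ∑ i, y i)) := by
      intro y
      rw [Fin.prod_univ_succ, Fin.sum_univ_succ]
      simp only [Fin.cons_zero, Fin.cons_succ, Fin.castSucc_zero, mul_assoc, ← sub_sub,
        Fin.succ_last, Fin.succ_castSucc]
    simp only [hcons, hint]
    rw [lintegral_const_mul _ (by fun_prop),
      ih (fun i => a i.succ) (fun i => ha _) (sub_ne_zero.2 hx.symm)]

@[fun_prop]
lemma measurable_simplexPoint {m : ℕ} : Measurable (simplexPoint (m := m)) := by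
  refine measurable_pi_lambda _ fun i => ?_
  refine Fin.lastCases ?_ (fun j => ?_) i
  · simp only [simplexPoint, Fin.snoc_last]; fun_prop
  · simp only [simplexPoint, Fin.snoc_castSucc]; fun_prop

lemma sum_simplexPoint {m : ℕ} (y : Fin m → ℝ) : ∑ i, simplexPoint y i = 1 := by
  simp [Fin.sum_univ_castSucc, simplexPoint]

lemma Gamma_add_nat_eq {a : ℝ} (ha : 0 < a) (k : ℕ) :
    Real.Gamma (a + k) = Real.Gamma a * (ascPochhammer ℝ k).eval a := by
  induction k with
  | zero => simp
  | succ k ih =>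
    rw [ascPochhammer_succ_eval, Nat.cast_succ, ← add_assoc, Real.Gamma_add_one (by positivity), ih]
    ring

lemma ofReal_mul_prod_rpow_mul_pow {m : ℕ} {α : Fin (m + 1) → ℝ} (hα : ∀ i, 0 < α i)
    (k : Fin (m + 1) → ℕ) {y : Fin (m + 1) → ℝ} (hy : ∀ i, 0 ≤ y i) :
    (1 / multiBeta α * ∏ i, y i ^ (α i - 1)) * ∏ i, y i ^ k i =
      (∏ i, Real.Gamma (α i + k i)) / multiBeta α *
        ∏ i, y i ^ (α i + k i - 1) / Real.Gamma (α i + k i) := by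
  have h : ∀ i, y i ^ (α i + k i - 1) = y i ^ (α i - 1) * y i ^ k i := by
    intro i
    rcases Nat.eq_zero_or_pos (k i) with h | h
    · simp [h]
    -- For `k i ≠ 0` the exponent `α i - 1 + k i` is positive, so the rule also holds at `y i = 0`.
    · have h1 : (1 : ℝ) ≤ k i := by exact_mod_cast h
      rw [show α i + k i - 1 = α i - 1 + (k i : ℝ) by ring, Real.rpow_add_natCast' (hy i)]
      have := hα i
      linarith
  have hΓ : ∏ i, Real.Gamma (α i + k i) ≠ 0 :=
    Finset.prod_ne_zero_iff.2 fun i _ => (Real.Gamma_pos_of_pos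
      (add_pos_of_pos_of_nonneg (hα i) (Nat.cast_nonneg _))).ne'
  simp only [h, Finset.prod_div_distrib, Finset.prod_mul_distrib]
  field_simp

lemma multiBeta_pos {m : ℕ} {α : Fin (m + 1) → ℝ} (hα : ∀ i, 0 < α i) : 0 < multiBeta α :=
  div_pos (Finset.prod_pos fun i _ => Real.Gamma_pos_of_pos (hα i))
    (Real.Gamma_pos_of_pos (Finset.sum_pos (fun i _ => hα i) Finset.univ_nonempty))

lemma lintegral_dirichletDistribution_pow {m : ℕ} {α : Fin (m + 1) → ℝ} (hα : ∀ i, 0 < α i)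
    (k : Fin (m + 1) → ℕ) :
    ∫⁻ y, ENNReal.ofReal (∏ i, y i ^ k i) ∂(dirichletDistribution α) =
      ENNReal.ofReal ((∏ i, (ascPochhammer ℝ (k i)).eval (α i)) /
        (ascPochhammer ℝ (∑ i, k i)).eval (∑ i, α i)) := by
  have hS : MeasurableSet {y : Fin m → ℝ | simplexPoint y ∈ stdSimplex ℝ (Fin (m + 1))} :=
    measurable_simplexPoint (isClosed_stdSimplex ℝ (Fin (m + 1))).measurableSet
  have hsum : 0 < ∑ i, α i := Finset.sum_pos (fun i _ => hα i) Finset.univ_nonempty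
  have hαk : ∀ i, 0 < α i + k i := fun i => add_pos_of_pos_of_nonneg (hα i) (Nat.cast_nonneg _)
  have hB := multiBeta_pos hα
  have hΓk : 0 ≤ ∏ i, Real.Gamma (α i + k i) :=
    Finset.prod_nonneg fun i _ => (Real.Gamma_pos_of_pos (hαk i)).le
  have key : ∀ y : Fin m → ℝ,
      Set.indicator {y : Fin m → ℝ | simplexPoint y ∈ stdSimplex ℝ (Fin (m + 1))}
        (fun y => ENNReal.ofReal ((1 / multiBeta α) * ∏ i, simplexPoint y i ^ (α i - 1)) *
          ENNReal.ofReal (∏ i, simplexPoint y i ^ k i)) y =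
      ENNReal.ofReal ((∏ i, Real.Gamma (α i + k i)) / multiBeta α) *
        ∏ i, fracKernel (α i + k i) (simplexPoint y i) := by
    intro y
    by_cases hy : ∀ i, 0 ≤ simplexPoint y i
    · rw [Set.indicator_of_mem (show y ∈ {y : Fin m → ℝ |
          simplexPoint y ∈ stdSimplex ℝ (Fin (m + 1))} from ⟨hy, sum_simplexPoint y⟩),
        ← ENNReal.ofReal_mul (mul_nonneg (by positivity)
          (Finset.prod_nonneg fun i _ => Real.rpow_nonneg (hy i) _)),
        ofReal_mul_prod_rpow_mul_pow hα k hy, ENNReal.ofReal_mul (by positivity),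
        ENNReal.ofReal_prod_of_nonneg]
      · simp [fracKernel, hy]
      · exact fun i _ => div_nonneg (Real.rpow_nonneg (hy i) _) (Real.Gamma_pos_of_pos (hαk i)).le
    · rw [Set.indicator_of_notMem (fun h => hy h.1)]
      push Not at hy
      obtain ⟨i, hi⟩ := hy
      rw [Finset.prod_eq_zero (f := fun i => fracKernel (α i + k i) (simplexPoint y i))
        (Finset.mem_univ i) (fracKernel_of_neg hi), mul_zero]
  rw [dirichletDistribution, lintegral_map (by fun_prop) measurable_simplexPoint,
    lintegral_withDensity_eq_lintegral_mul _ (by fun_prop) (by fun_prop),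
    ← lintegral_indicator hS]
  refine (lintegral_congr key).trans ?_
  rw [lintegral_const_mul _ (by fun_prop)]
  have h1 := lintegral_prod_fracKernel (fun i => α i + k i) hαk one_ne_zero
  simp only [Fin.prod_univ_castSucc, simplexPoint, Fin.snoc_castSucc, Fin.snoc_last] at h1 ⊢
  rw [h1]
  simp only [fracKernel, zero_le_one, if_true, Real.one_rpow]
  rw [← ENNReal.ofReal_mul
    (by rw [← Fin.prod_univ_castSucc (fun i => Real.Gamma (α i + k i))]; positivity)]
  congr 1
  simp only [← Fin.prod_univ_castSucc (fun i => Real.Gamma (α i + k i)),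
    ← Fin.prod_univ_castSucc (fun i => (ascPochhammer ℝ (k i)).eval (α i))]
  rw [Finset.sum_add_distrib, ← Nat.cast_sum, Gamma_add_nat_eq hsum, multiBeta]
  simp only [Gamma_add_nat_eq (hα _), Finset.prod_mul_distrib]
  have h2 : ∏ i, Real.Gamma (α i) ≠ 0 :=
    Finset.prod_ne_zero_iff.2 fun i _ => (Real.Gamma_pos_of_pos (hα i)).ne'
  have h3 := (Real.Gamma_pos_of_pos hsum).ne'
  have h4 := (ascPochhammer_pos (∑ i, k i) _ hsum).ne'
  field_simp

/-! ### Cell moments of the Dirichlet–Ferguson measure -/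

section Moments

variable {X : Type*} [MeasurableSpace X] {σ : Measure X} {𝒟 : Measure (ProbabilityMeasure X)}

@[fun_prop]
lemma measurable_coe_probabilityMeasure :
    Measurable (fun η : ProbabilityMeasure X => (η : Measure X)) :=
  measurable_subtype_coe

lemma measurable_probabilityMeasure_real {s : Set X} (hs : MeasurableSet s) :
    Measurable (fun η : ProbabilityMeasure X => (η : Measure X).real s) :=
  ((Measure.measurable_coe hs).comp measurable_coe_probabilityMeasure).ennreal_toReal

namespace IsDirichletFerguson

variable [IsProbabilityMeasure σ]

/-- The case `m = 0`, not covered by the defining property of `𝒟`, holds because `η` is a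
probability measure. -/
lemma integral_prod_fin_pow (h𝒟 : IsDirichletFerguson σ 𝒟) {m : ℕ} {π : X → Fin (m + 1)}
    (hπ : Measurable π) (hpos : ∀ j, 0 < σ (π ⁻¹' {j})) (k : Fin (m + 1) → ℕ) :
    ∫ η : ProbabilityMeasure X, ∏ j, (η : Measure X).real (π ⁻¹' {j}) ^ k j ∂𝒟 =
      (∏ j, (ascPochhammer ℝ (k j)).eval (σ.real (π ⁻¹' {j}))) / (∑ j, k j).factorial := by
  have := h𝒟.isProbabilityMeasure
  have hmeas : ∀ j, MeasurableSet (π ⁻¹' {j}) := fun j => hπ (measurableSet_singleton j)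
  have hreal : ∀ j, 0 < σ.real (π ⁻¹' {j}) := fun j =>
    ENNReal.toReal_pos (hpos j).ne' (measure_ne_top _ _)
  rcases Nat.eq_zero_or_pos m with rfl | hm
  · have h1 : π ⁻¹' {0} = Set.univ := by
      ext x; simp [Fin.fin_one_eq_zero (π x)]
    have h2 : ((k 0).factorial : ℝ) ≠ 0 := Nat.cast_ne_zero.2 (Nat.factorial_ne_zero _)
    simp [h1, div_self h2]
  have hdisj : Pairwise fun i j => Disjoint (π ⁻¹' {i}) (π ⁻¹' {j}) := fun i j hij =>
    Disjoint.preimage _ (by simpa using hij)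
  have hcover : ⋃ j, π ⁻¹' {j} = Set.univ := by ext x; simp
  have hsum : ∑ j, σ.real (π ⁻¹' {j}) = 1 := by
    rw [← measureReal_iUnion_fintype hdisj hmeas, hcover, probReal_univ]
  have hmap := h𝒟.map_eval m hm (fun j => π ⁻¹' {j}) hmeas hdisj hcover hpos
  have hvec : Measurable fun (η : ProbabilityMeasure X) j => (η : Measure X).real (π ⁻¹' {j}) :=
    measurable_pi_lambda _ fun j => measurable_probabilityMeasure_real (hmeas j)
  rw [integral_eq_lintegral_of_nonneg_ae
    (Filter.Eventually.of_forall fun η => Finset.prod_nonneg fun j _ => by positivity)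
    (Finset.measurable_fun_prod _ fun j _ =>
      (measurable_probabilityMeasure_real (hmeas j)).pow_const _).aestronglyMeasurable]
  have h := lintegral_dirichletDistribution_pow hreal k
  rw [← hmap, lintegral_map (by fun_prop) hvec, hsum, ascPochhammer_eval_one] at h
  rw [h, ENNReal.toReal_ofReal]
  exact div_nonneg (Finset.prod_nonneg fun j _ => (ascPochhammer_pos _ _ (hreal j)).le)
    (Nat.cast_nonneg _)

lemma integral_prod_pow_of_pos (h𝒟 : IsDirichletFerguson σ 𝒟) {ι : Type*} [Fintype ι]
    [Nonempty ι] [MeasurableSpace ι] [DiscreteMeasurableSpace ι] {π : X → ι}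
    (hπ : Measurable π) (hpos : ∀ j, 0 < σ (π ⁻¹' {j})) (k : ι → ℕ) :
    ∫ η : ProbabilityMeasure X, ∏ j, (η : Measure X).real (π ⁻¹' {j}) ^ k j ∂𝒟 =
      (∏ j, (ascPochhammer ℝ (k j)).eval (σ.real (π ⁻¹' {j}))) / (∑ j, k j).factorial := by
  obtain ⟨m, hm⟩ := Nat.exists_eq_succ_of_ne_zero (Fintype.card_ne_zero (α := ι))
  let e : ι ≃ Fin (m + 1) := Fintype.equivFinOfCardEq hm
  have hpre : ∀ j, (e ∘ π) ⁻¹' {j} = π ⁻¹' {e.symm j} := by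
    intro j; ext x; simp [Equiv.eq_symm_apply]
  have h := h𝒟.integral_prod_fin_pow (π := e ∘ π) ((measurable_of_finite e).comp hπ)
    (fun j => by rw [hpre]; exact hpos _) (fun j => k (e.symm j))
  simp only [hpre] at h
  rw [e.symm.sum_comp k, e.symm.prod_comp
    (fun j => (ascPochhammer ℝ (k j)).eval (σ.real (π ⁻¹' {j})))] at h
  rw [← h]
  exact integral_congr_ae (Filter.Eventually.of_forall fun η =>
    (e.symm.prod_comp (fun j => (η : Measure X).real (π ⁻¹' {j}) ^ k j)).symm)

/-- The joint moments of the cells `π ⁻¹' {j}`, some of which may be `σ`-null: both sides vanish if a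
null cell occurs with a positive exponent, and otherwise the null cells can be merged into a cell of
positive measure. -/
theorem integral_prod_pow (h𝒟 : IsDirichletFerguson σ 𝒟) {ι : Type*} [Fintype ι]
    [MeasurableSpace ι] [DiscreteMeasurableSpace ι] {π : X → ι} (hπ : Measurable π) (k : ι → ℕ) :
    ∫ η : ProbabilityMeasure X, ∏ j, (η : Measure X).real (π ⁻¹' {j}) ^ k j ∂𝒟 =
      (∏ j, (ascPochhammer ℝ (k j)).eval (σ.real (π ⁻¹' {j}))) / (∑ j, k j).factorial := by
  classical
  have hnull : ∀ᵐ η : ProbabilityMeasure X ∂𝒟, ∀ j, σ (π ⁻¹' {j}) = 0 →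
      (η : Measure X) (π ⁻¹' {j}) = 0 := by
    refine ae_all_iff.2 fun j => ?_
    by_cases hj : σ (π ⁻¹' {j}) = 0
    · filter_upwards [h𝒟.null _ (hπ (measurableSet_singleton j)) hj] with η hη _ using hη
    · exact Filter.Eventually.of_forall fun η h => absurd h hj
  by_cases hk : ∃ j, σ (π ⁻¹' {j}) = 0 ∧ k j ≠ 0
  · obtain ⟨j, hj, hkj⟩ := hk
    rw [Finset.prod_eq_zero (Finset.mem_univ j), zero_div]
    · refine integral_eq_zero_of_ae ?_
      filter_upwards [hnull] with η hη
      refine Finset.prod_eq_zero (Finset.mem_univ j) ?_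
      rw [measureReal_def, hη j hj, ENNReal.toReal_zero, zero_pow hkj]
    · rw [measureReal_def, hj, ENNReal.toReal_zero, ascPochhammer_ne_zero_eval_zero _ hkj]
  push Not at hk
  let ι' := {j // 0 < σ (π ⁻¹' {j})}
  have hN : ∀ μ : Measure X, (∀ j, σ (π ⁻¹' {j}) = 0 → μ (π ⁻¹' {j}) = 0) →
      ∀ᵐ x ∂μ, 0 < σ (π ⁻¹' {π x}) := by
    intro μ hμ
    refine measure_mono_null (t := ⋃ j : {j // σ (π ⁻¹' {j}) = 0}, π ⁻¹' {j.1}) (fun x hx => ?_)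
      (measure_iUnion_null fun j => hμ _ j.2)
    exact Set.mem_iUnion.2 ⟨⟨π x, nonpos_iff_eq_zero.1 (not_lt.1 hx)⟩, rfl⟩
  obtain ⟨x₀, hx₀⟩ := (hN σ fun _ h => h).exists
  -- `ρ` sends every index of a null cell to the fixed non-null cell containing `x₀`.
  let ρ : ι → ι' := fun j => if h : 0 < σ (π ⁻¹' {j}) then ⟨j, h⟩ else ⟨π x₀, hx₀⟩
  have hne : Nonempty ι' := ⟨⟨π x₀, hx₀⟩⟩
  have hpre : ∀ μ : Measure X, (∀ j, σ (π ⁻¹' {j}) = 0 → μ (π ⁻¹' {j}) = 0) →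
      ∀ j : ι', μ ((ρ ∘ π) ⁻¹' {j}) = μ (π ⁻¹' {j.1}) := by
    intro μ hμ j
    refine measure_congr ?_
    filter_upwards [hN μ hμ] with x hx
    refine propext ?_
    change ρ (π x) = j ↔ π x = j.1
    simp only [ρ, hx, dif_pos]
    exact Subtype.ext_iff
  have h := h𝒟.integral_prod_pow_of_pos (π := ρ ∘ π) ((measurable_of_finite ρ).comp hπ)
    (fun j => by rw [hpre σ fun _ h => h]; exact j.2) (fun j => k j.1)
  have hoff : ∀ i ∉ Set.range (Subtype.val : ι' → ι), k i = 0 := by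
    intro i hi
    refine hk i (nonpos_iff_eq_zero.1 (not_lt.1 fun h => hi ⟨⟨i, h⟩, rfl⟩))
  rw [Fintype.sum_of_injective (Subtype.val : ι' → ι) Subtype.val_injective (fun j => k j.1) k hoff
    fun _ => rfl] at h
  rw [← Fintype.prod_of_injective (Subtype.val : ι' → ι) Subtype.val_injective
    (fun j => (ascPochhammer ℝ (k j.1)).eval (σ.real ((ρ ∘ π) ⁻¹' {j}))) _
    (fun i hi => by simp [hoff i hi])
    (fun j => by rw [measureReal_def, measureReal_def, hpre σ fun _ h => h]), ← h]
  refine integral_congr_ae ?_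
  filter_upwards [hnull] with η hη
  exact (Fintype.prod_of_injective (Subtype.val : ι' → ι) Subtype.val_injective _ _
    (fun i hi => by simp [hoff i hi])
    (fun j => by rw [measureReal_def, measureReal_def, hpre _ hη])).symm

end IsDirichletFerguson

end Moments

/-! ### A recursion for products of rising factorials -/

lemma sum_descFactorial_mul_ascPochhammer (a : ℝ) (N : ℕ) :
    ∑ s ∈ Finset.range N, (N.descFactorial (s + 1) : ℝ) *
      ((ascPochhammer ℝ (N - (s + 1))).eval a * a) = N * (ascPochhammer ℝ N).eval a := by
  induction N with
  | zero => simp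
  | succ N ih =>
    have h : ∀ s, ((N + 1).descFactorial (s + 1 + 1) : ℝ) *
        ((ascPochhammer ℝ (N + 1 - (s + 1 + 1))).eval a * a) =
        (N + 1) * ((N.descFactorial (s + 1) : ℝ) *
          ((ascPochhammer ℝ (N - (s + 1))).eval a * a)) := by
      intro s
      rw [Nat.succ_descFactorial_succ, Nat.add_sub_add_right]
      push_cast
      ring
    rw [Finset.sum_range_succ', Finset.sum_congr rfl fun s _ => h s, ← Finset.mul_sum, ih,
      ascPochhammer_succ_eval]
    simp
    ring

section Weights

variable {ι : Type*} [Fintype ι] [DecidableEq ι] {n : ℕ}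

/-- The moment `E ∏ i ∈ ξ, y (f i)` of a vector `y` with Dirichlet distribution of parameter `a`,
`∑ j, a j = 1`: a product of rising factorials `a j (a j + 1) ⋯` over the fibre sizes of `f` on `ξ`,
divided by `|ξ|!`. -/
noncomputable def urnWeight (a : ι → ℝ) (f : Fin n → ι) (ξ : Finset (Fin n)) : ℝ :=
  (∏ j, (ascPochhammer ℝ {i ∈ ξ | f i = j}.card).eval (a j)) / ξ.card.factorial

lemma inv_choose_mul_urnWeight_compl (a : ι → ℝ) (f : Fin n → ι) (j : ι) {S : Finset (Fin n)}
    (hS : ∀ i ∈ S, f i = j) :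
    (n.choose Sᶜ.card : ℝ)⁻¹ * urnWeight a f Sᶜ =
      S.card.factorial *
        (ascPochhammer ℝ (({i | f i = j} : Finset (Fin n)).card - S.card)).eval (a j) *
        ((∏ l ∈ Finset.univ.erase j,
          (ascPochhammer ℝ ({i | f i = l} : Finset (Fin n)).card).eval (a l)) /
          n.factorial) := by
  have hle : S.card ≤ n := by simpa using S.card_le_univ
  have hj : {i ∈ Sᶜ | f i = j}.card = ({i | f i = j} : Finset (Fin n)).card - S.card := by
    have hsub : S ⊆ ({i | f i = j} : Finset (Fin n)) := fun i hi => by simpa using hS i hi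
    rw [← Finset.card_sdiff_of_subset hsub]
    congr 1
    ext i
    simp [and_comm]
  have hl : ∀ l ∈ Finset.univ.erase j, {i ∈ Sᶜ | f i = l} = ({i | f i = l} : Finset (Fin n)) := by
    intro l hl
    ext i
    simp only [Finset.mem_filter, Finset.mem_compl, Finset.mem_univ, true_and, and_iff_right_iff_imp]
    rintro rfl hi
    exact (Finset.mem_erase.1 hl).1 (hS i hi)
  rw [urnWeight, ← Finset.mul_prod_erase _ _ (Finset.mem_univ j), hj,
    Finset.prod_congr rfl fun l h => by rw [hl l h], Finset.card_compl, Fintype.card_fin,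
    Nat.choose_symm hle, Nat.cast_choose ℝ hle]
  have h1 : (n.factorial : ℝ) ≠ 0 := Nat.cast_ne_zero.2 (Nat.factorial_ne_zero _)
  have h2 : ((n - S.card).factorial : ℝ) ≠ 0 := Nat.cast_ne_zero.2 (Nat.factorial_ne_zero _)
  have h3 : (S.card.factorial : ℝ) ≠ 0 := Nat.cast_ne_zero.2 (Nat.factorial_ne_zero _)
  field_simp

/-- The recursion for indicator functions of cells: the inner sum over `j` is
`∫ ∏ i ∈ ξᶜ, g i ∂σ` when `g i` is the indicator of the cell `f i` and cell `j` has mass `a j`. -/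
lemma sum_inv_choose_mul_urnWeight (a : ι → ℝ) (f : Fin n → ι) :
    ∑ ξ : Finset (Fin n) with ξ.card < n, (n.choose ξ.card : ℝ)⁻¹ *
      (urnWeight a f ξ * ∑ j, if ∀ i ∈ ξᶜ, f i = j then a j else 0) =
      n * urnWeight a f Finset.univ := by
  set F : ι → Finset (Fin n) := fun j => {i | f i = j} with hF
  set Q : ι → ℝ := fun j =>
    (∏ l ∈ Finset.univ.erase j, (ascPochhammer ℝ (F l).card).eval (a l)) / n.factorial with hQ
  set h : ι → ℕ → ℝ := fun j s => if s = 0 then 0 else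
    s.factorial * ((ascPochhammer ℝ ((F j).card - s)).eval (a j) * a j) * Q j with hh
  have hinner : ∀ j, ∑ S ∈ (F j).powerset, h j S.card =
      (F j).card * urnWeight a f Finset.univ := by
    intro j
    have hterm : ∀ s, (F j).card.choose (s + 1) • h j (s + 1) =
        (((F j).card.descFactorial (s + 1) : ℝ) *
          ((ascPochhammer ℝ ((F j).card - (s + 1))).eval (a j) * a j)) * Q j := by
      intro s
      rw [Nat.descFactorial_eq_factorial_mul_choose, nsmul_eq_mul]
      simp only [hh, Nat.succ_ne_zero, if_false]
      push_cast
      ring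
    rw [Finset.sum_powerset_apply_card, Finset.sum_range_succ', Finset.sum_congr rfl
      fun s _ => hterm s, ← Finset.sum_mul, sum_descFactorial_mul_ascPochhammer, urnWeight,
      ← Finset.mul_prod_erase _ _ (Finset.mem_univ j), Finset.card_univ, Fintype.card_fin]
    simp only [hh, hQ, hF]
    simp only [if_true, smul_zero, add_zero]
    ring
  have hcard : ∑ j, ((F j).card : ℝ) = n := by
    rw [← Nat.cast_sum, ← Finset.card_eq_sum_card_fiberwise (fun _ _ => Finset.mem_univ _)]
    simp
  -- Pass to the complements `S = ξᶜ`, the nonempty subsets of the fibres of `f`; `h j 0 = 0` takes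
  -- care of the empty set.
  calc _ = ∑ S : Finset (Fin n) with S ≠ ∅, ∑ j, if S ⊆ F j then h j S.card else 0 := by
        refine Finset.sum_nbij' (fun ξ => ξᶜ) (fun ξ => ξᶜ) ?_ ?_ ?_ ?_ ?_
        · intro ξ hξ
          simp only [Finset.mem_filter, Finset.mem_univ, true_and] at hξ ⊢
          intro h0
          rw [Finset.compl_eq_empty_iff] at h0
          simp [h0] at hξ
        · intro S hS
          simp only [Finset.mem_filter, Finset.mem_univ, true_and] at hS ⊢
          simpa using (Finset.card_lt_univ_of_notMem (s := Sᶜ)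
            (x := (Finset.nonempty_iff_ne_empty.2 hS).choose)
            (by simpa using (Finset.nonempty_iff_ne_empty.2 hS).choose_spec))
        · simp
        · simp
        · intro ξ hξ
          have hne : ξᶜ.card ≠ 0 := by
            simp only [Finset.mem_filter, Finset.mem_univ, true_and] at hξ
            rw [Finset.card_compl, Fintype.card_fin]
            omega
          rw [← mul_assoc, Finset.mul_sum]
          refine Finset.sum_congr rfl fun j _ => ?_
          by_cases hj : ∀ i ∈ ξᶜ, f i = j
          · have hsub : ξᶜ ⊆ F j := fun i hi => by simpa [hF] using hj i hi
            have := inv_choose_mul_urnWeight_compl a f j hj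
            rw [compl_compl] at this
            rw [if_pos hj, if_pos hsub, this]
            simp only [hh, hne, if_false, hQ, hF]
            ring
          · have hsub : ¬ ξᶜ ⊆ F j := fun hs => hj fun i hi => by simpa [hF] using hs hi
            rw [if_neg hj, if_neg hsub, mul_zero]
    _ = ∑ j, ∑ S ∈ (F j).powerset, h j S.card := by
        rw [Finset.sum_comm]
        refine Finset.sum_congr rfl fun j _ => ?_
        rw [← Finset.sum_filter, Finset.filter_filter]
        refine Finset.sum_subset (fun S hS => ?_) (fun S hS hS' => ?_)
        · exact Finset.mem_powerset.2 (Finset.mem_filter.1 hS).2.2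
        · have : S = ∅ := by
            by_contra h0
            exact hS' (Finset.mem_filter.2 ⟨Finset.mem_univ _, h0, Finset.mem_powerset.1 hS⟩)
          simp [this, hh]
    _ = n * urnWeight a f Finset.univ := by
        rw [Finset.sum_congr rfl fun j _ => hinner j, ← Finset.sum_mul, hcard]

end Weights

/-! ### Mixed moments and the recursion for bounded functions -/

section MixedMoments

open Filter Topology ProbabilityTheory

variable {X : Type*} [MeasurableSpace X] {n : ℕ}

lemma measurable_integral_probabilityMeasure {g : X → ℝ} (hg : Measurable g) :
    Measurable (fun η : ProbabilityMeasure X => ∫ x, g x ∂(η : Measure X)) := by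
  let κ : Kernel (ProbabilityMeasure X) X :=
    ⟨fun η => (η : Measure X), measurable_coe_probabilityMeasure⟩
  have : IsMarkovKernel κ := ⟨fun η => inferInstanceAs (IsProbabilityMeasure (η : Measure X))⟩
  exact (hg.stronglyMeasurable.integral_kernel (κ := κ)).measurable

lemma abs_integral_probabilityMeasure_le {g : X → ℝ} {C : ℝ} (hC : ∀ x, |g x| ≤ C)
    (μ : Measure X) [IsProbabilityMeasure μ] : |∫ x, g x ∂μ| ≤ C := by
  simpa using norm_integral_le_of_norm_le_const (f := g) (C := C) (μ := μ)
    (Eventually.of_forall hC)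

/-- The `i`-th factor of a mixed moment at `z = (η, x)`: the mean of `g i` under `η` if `i ∈ ξ`, and
the value of `g i` at `x` otherwise. -/
noncomputable def mixedFactor (ξ : Finset (Fin n)) (g : Fin n → X → ℝ)
    (z : ProbabilityMeasure X × X) (i : Fin n) : ℝ :=
  if i ∈ ξ then ∫ x, g i x ∂(z.1 : Measure X) else g i z.2

/-- The integral of the product of all factors under `𝒟.prod σ`; it splits into an integral over `𝒟`
and one over `σ` by `mixedMoment_eq`. -/
noncomputable def mixedMoment (σ : Measure X) (𝒟 : Measure (ProbabilityMeasure X))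
    (ξ : Finset (Fin n)) (g : Fin n → X → ℝ) : ℝ :=
  ∫ z, ∏ i, mixedFactor ξ g z i ∂(𝒟.prod σ)

lemma measurable_mixedFactor {ξ : Finset (Fin n)} {g : Fin n → X → ℝ}
    (hg : ∀ i, Measurable (g i)) (i : Fin n) : Measurable fun z => mixedFactor ξ g z i := by
  unfold mixedFactor
  split_ifs
  · exact (measurable_integral_probabilityMeasure (hg i)).comp measurable_fst
  · exact (hg i).comp measurable_snd

lemma abs_mixedFactor_le {ξ : Finset (Fin n)} {g : Fin n → X → ℝ} {C : ℝ}
    (hC : ∀ i x, |g i x| ≤ C) (z : ProbabilityMeasure X × X) (i : Fin n) :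
    |mixedFactor ξ g z i| ≤ C := by
  unfold mixedFactor
  split_ifs
  · exact abs_integral_probabilityMeasure_le (hC i) _
  · exact hC i _

lemma abs_prod_mixedFactor_le {ξ : Finset (Fin n)} {g : Fin n → X → ℝ} {C : ℝ}
    (hC : ∀ i x, |g i x| ≤ C) (z : ProbabilityMeasure X × X) :
    |∏ i, mixedFactor ξ g z i| ≤ C ^ n := by
  rw [Finset.abs_prod]
  refine (Finset.prod_le_prod (fun i _ => abs_nonneg _) fun i _ =>
    abs_mixedFactor_le hC z i).trans_eq ?_
  simp

lemma measurable_prod_mixedFactor {ξ : Finset (Fin n)} {g : Fin n → X → ℝ}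
    (hg : ∀ i, Measurable (g i)) : Measurable fun z => ∏ i, mixedFactor ξ g z i :=
  Finset.measurable_fun_prod _ fun i _ => measurable_mixedFactor hg i

lemma mixedMoment_eq {σ : Measure X} {𝒟 : Measure (ProbabilityMeasure X)}
    [SFinite σ] [SFinite 𝒟] (ξ : Finset (Fin n)) (g : Fin n → X → ℝ) :
    mixedMoment σ 𝒟 ξ g =
      (∫ η : ProbabilityMeasure X, ∏ i ∈ ξ, ∫ x, g i x ∂(η : Measure X) ∂𝒟) *
        ∫ x, ∏ j ∈ ξᶜ, g j x ∂σ := by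
  rw [mixedMoment, ← integral_prod_mul]
  refine integral_congr_ae (Eventually.of_forall fun z => ?_)
  simp only [mixedFactor]
  rw [← Finset.prod_mul_prod_compl ξ]
  congr 1
  · exact Finset.prod_congr rfl fun i hi => if_pos hi
  · exact Finset.prod_congr rfl fun i hi => if_neg (Finset.mem_compl.1 hi)

lemma tendsto_mixedMoment {σ : Measure X} {𝒟 : Measure (ProbabilityMeasure X)}
    [IsFiniteMeasure σ] [IsFiniteMeasure 𝒟] (ξ : Finset (Fin n)) {G : ℕ → Fin n → X → ℝ}
    {g : Fin n → X → ℝ} (hG : ∀ N i, Measurable (G N i)) {C : ℝ} (hC : ∀ N i x, |G N i x| ≤ C)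
    (hlim : ∀ i x, Tendsto (fun N => G N i x) atTop (𝓝 (g i x))) :
    Tendsto (fun N => mixedMoment σ 𝒟 ξ (G N)) atTop (𝓝 (mixedMoment σ 𝒟 ξ g)) := by
  refine tendsto_integral_of_dominated_convergence (fun _ => C ^ n)
    (fun N => (measurable_prod_mixedFactor (hG N)).aestronglyMeasurable) (integrable_const _)
    (fun N => Eventually.of_forall fun z => abs_prod_mixedFactor_le (hC N) z)
    (Eventually.of_forall fun z => tendsto_finsetProd _ fun i _ => ?_)
  unfold mixedFactor
  split_ifs
  · exact tendsto_integral_of_dominated_convergence (fun _ => C)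
      (fun N => (hG N i).aestronglyMeasurable) (integrable_const _)
      (fun N => Eventually.of_forall fun x => hC N i x) (Eventually.of_forall fun x => hlim i x)
  · exact hlim i _

section FiniteValued

variable {ι : Type*} [Fintype ι] [MeasurableSpace ι] [DiscreteMeasurableSpace ι] {π : X → ι}

lemma integral_comp_fintype (hπ : Measurable π) (h : ι → ℝ) (μ : Measure X) [IsFiniteMeasure μ] :
    ∫ x, h (π x) ∂μ = ∑ v, μ.real (π ⁻¹' {v}) * h v := by
  rw [← integral_map (f := h) hπ.aemeasurable (measurable_of_finite h).aestronglyMeasurable,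
    integral_fintype .of_finite]
  exact Finset.sum_congr rfl fun v _ => by
    rw [map_measureReal_apply hπ (measurableSet_singleton v), smul_eq_mul]

variable [DecidableEq ι]

/-- Multilinear expansion of a mixed moment of finitely valued functions into those of indicators. -/
lemma mixedMoment_comp (hπ : Measurable π) (c : ι → Fin n → ℝ) {σ : Measure X}
    {𝒟 : Measure (ProbabilityMeasure X)} [IsFiniteMeasure σ] [IsFiniteMeasure 𝒟]
    (ξ : Finset (Fin n)) :
    mixedMoment σ 𝒟 ξ (fun i x => c (π x) i) = ∑ f : Fin n → ι, (∏ i, c (f i) i) *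
      mixedMoment σ 𝒟 ξ (fun i x => if π x = f i then 1 else 0) := by
  have hfac : ∀ z i, mixedFactor ξ (fun i x => c (π x) i) z i =
      ∑ v, c v i * mixedFactor ξ (fun _ x => if π x = v then 1 else 0) z i := by
    intro z i
    unfold mixedFactor
    split_ifs with hi
    · rw [integral_comp_fintype hπ (fun v => c v i)]
      refine Finset.sum_congr rfl fun v _ => ?_
      rw [integral_comp_fintype hπ (fun w => if w = v then 1 else 0)]
      simp [mul_comm]
    · simp
  have hprod : ∀ z, ∏ i, mixedFactor ξ (fun i x => c (π x) i) z i = ∑ f : Fin n → ι,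
      (∏ i, c (f i) i) * ∏ i, mixedFactor ξ (fun i x => if π x = f i then 1 else 0) z i := by
    intro z
    simp only [hfac, Finset.prod_univ_sum, Fintype.piFinset_univ, Finset.prod_mul_distrib]
    rfl
  simp only [mixedMoment, hprod]
  rw [integral_finsetSum]
  · exact Finset.sum_congr rfl fun f _ => integral_const_mul _ _
  · intro f _
    refine Integrable.const_mul (Integrable.of_bound
      (measurable_prod_mixedFactor fun i => ?_).aestronglyMeasurable (1 ^ n)
      (Eventually.of_forall (abs_prod_mixedFactor_le fun i x => ?_))) _
    · exact (measurable_of_finite fun v => if v = f i then (1 : ℝ) else 0).comp hπ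
    · split_ifs <;> simp

lemma mixedMoment_cells {σ : Measure X} [IsProbabilityMeasure σ]
    {𝒟 : Measure (ProbabilityMeasure X)} (h𝒟 : IsDirichletFerguson σ 𝒟) (hπ : Measurable π)
    (f : Fin n → ι) (ξ : Finset (Fin n)) :
    mixedMoment σ 𝒟 ξ (fun i x => if π x = f i then 1 else 0) =
      urnWeight (fun v => σ.real (π ⁻¹' {v})) f ξ *
        ∑ v, if ∀ i ∈ ξᶜ, f i = v then σ.real (π ⁻¹' {v}) else 0 := by
  have := h𝒟.isProbabilityMeasure
  rw [mixedMoment_eq]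
  congr 1
  · rw [urnWeight]
    have hcard : ξ.card = ∑ v, {i ∈ ξ | f i = v}.card :=
      Finset.card_eq_sum_card_fiberwise fun _ _ => Finset.mem_univ _
    rw [hcard, ← h𝒟.integral_prod_pow hπ]
    refine integral_congr_ae (Eventually.of_forall fun η => ?_)
    simp only
    rw [← Finset.prod_fiberwise ξ f]
    refine Finset.prod_congr rfl fun v _ => Finset.prod_eq_pow_card fun i hi => ?_
    rw [integral_comp_fintype hπ (fun w => if w = f i then 1 else 0)]
    simp [(Finset.mem_filter.1 hi).2]
  · rw [integral_comp_fintype hπ (fun w => ∏ j ∈ ξᶜ, if w = f j then (1 : ℝ) else 0)]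
    refine Finset.sum_congr rfl fun v _ => ?_
    rw [Finset.prod_boole]
    simp [eq_comm]

lemma mixedMoment_recursion_of_finite {σ : Measure X} [IsProbabilityMeasure σ]
    {𝒟 : Measure (ProbabilityMeasure X)} (h𝒟 : IsDirichletFerguson σ 𝒟) (hπ : Measurable π)
    (c : ι → Fin n → ℝ) :
    ∑ ξ : Finset (Fin n) with ξ.card < n, (n.choose ξ.card : ℝ)⁻¹ *
      mixedMoment σ 𝒟 ξ (fun i x => c (π x) i) =
      n * mixedMoment σ 𝒟 Finset.univ (fun i x => c (π x) i) := by
  have := h𝒟.isProbabilityMeasure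
  have hsum : ∑ v, σ.real (π ⁻¹' {v}) = 1 := by
    simpa using (integral_comp_fintype hπ (fun _ => 1) σ).symm
  simp only [mixedMoment_comp hπ, mixedMoment_cells h𝒟 hπ]
  simp only [Finset.mul_sum (s := (Finset.univ : Finset (Fin n → ι)))]
  rw [Finset.sum_comm]
  refine Finset.sum_congr rfl fun f _ => ?_
  have h := sum_inv_choose_mul_urnWeight (fun v => σ.real (π ⁻¹' {v})) f
  simp only [Finset.compl_univ, Finset.notMem_empty, false_imp_iff, implies_true, if_true, hsum,
    mul_one]
  rw [mul_left_comm, ← h, Finset.mul_sum]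
  exact Finset.sum_congr rfl fun ξ _ => mul_left_comm _ _ _

end FiniteValued

theorem mixedMoment_recursion {σ : Measure X} [IsProbabilityMeasure σ]
    {𝒟 : Measure (ProbabilityMeasure X)} (h𝒟 : IsDirichletFerguson σ 𝒟) {g : Fin n → X → ℝ}
    (hg : ∀ i, Measurable (g i)) {C : ℝ} (hC : ∀ i x, |g i x| ≤ C) (hC0 : 0 ≤ C) :
    ∑ ξ : Finset (Fin n) with ξ.card < n, (n.choose ξ.card : ℝ)⁻¹ * mixedMoment σ 𝒟 ξ g =
      n * mixedMoment σ 𝒟 Finset.univ g := by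
  classical
  have := h𝒟.isProbabilityMeasure
  have hgm : Measurable fun x i => g i x := measurable_pi_lambda _ hg
  -- Approximating the vector `(g i)` as a whole makes all components factor through one finite map.
  let s : Set (Fin n → ℝ) := Set.univ.pi fun _ => Set.Icc (-C) C
  have h0 : (0 : Fin n → ℝ) ∈ s := fun i _ => by simpa using hC0
  let F : ℕ → SimpleFunc X (Fin n → ℝ) := fun N => SimpleFunc.approxOn _ hgm s 0 h0 N
  have hF : ∀ ξ, Tendsto (fun N => mixedMoment σ 𝒟 ξ (fun i x => F N x i)) atTop
      (𝓝 (mixedMoment σ 𝒟 ξ g)) := by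
    refine fun ξ => tendsto_mixedMoment ξ
      (fun N i => (measurable_pi_apply i).comp (F N).measurable) (C := C) (fun N i x => ?_)
      (fun i x => ?_)
    · exact abs_le.2 (SimpleFunc.approxOn_mem hgm h0 N x i (Set.mem_univ i))
    · exact tendsto_pi_nhds.1 (SimpleFunc.tendsto_approxOn hgm h0
        (subset_closure fun i _ => abs_le.1 (hC i x))) i
  refine tendsto_nhds_unique (tendsto_finsetSum _ fun ξ _ => (hF ξ).const_mul _) ?_
  refine ((hF Finset.univ).const_mul (n : ℝ)).congr fun N => ?_
  exact (mixedMoment_recursion_of_finite h𝒟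
    (π := fun x => (⟨F N x, (F N).mem_range_self x⟩ : (F N).range))
    ((F N).measurable.subtype_mk) (fun v i => v.1 i)).symm

end MixedMoments
theorem corollary3p4 {X : Type*} [TopologicalSpace X] [PolishSpace X] [LocallyCompactSpace X]
    [MeasurableSpace X] [BorelSpace X]
    (σ : Measure X) [IsProbabilityMeasure σ] [NullSingletonClass σ]
    (𝒟 : Measure (ProbabilityMeasure X)) (h𝒟 : IsDirichletFerguson σ 𝒟) :
    (∀ n : ℕ, 1 ≤ n → ∀ g : Fin n → X → ℝ,
      (∀ i, Measurable (g i)) → (∀ i, ∃ C : ℝ, ∀ x, |g i x| ≤ C) →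
      Integrable (fun η : ProbabilityMeasure X => ∏ i, ∫ x, g i x ∂(η : Measure X)) 𝒟 ∧
      ∫ η : ProbabilityMeasure X, ∏ i, ∫ x, g i x ∂(η : Measure X) ∂𝒟 =
        (1 / (n : ℝ)) * ∑ ξ : Finset (Fin n) with ξ.card < n,
          (n.choose ξ.card : ℝ)⁻¹ *
            (∫ η : ProbabilityMeasure X, ∏ i ∈ ξ, ∫ x, g i x ∂(η : Measure X) ∂𝒟) *
            ∫ x, ∏ j ∈ ξᶜ, g j x ∂σ) ∧
    (∀ n : ℕ, 1 ≤ n → ∀ g : X → ℝ, Measurable g → (∃ C : ℝ, ∀ x, |g x| ≤ C) →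
      ∫ η : ProbabilityMeasure X, (∫ x, g x ∂(η : Measure X)) ^ n ∂𝒟 =
        (1 / (n : ℝ)) * ∑ i ∈ Finset.range n,
          (∫ η : ProbabilityMeasure X, (∫ x, g x ∂(η : Measure X)) ^ i ∂𝒟) *
            ∫ x, g x ^ (n - i) ∂σ) := by
  have := h𝒟.isProbabilityMeasure
  have main : ∀ n : ℕ, 1 ≤ n → ∀ g : Fin n → X → ℝ,
      (∀ i, Measurable (g i)) → (∀ i, ∃ C : ℝ, ∀ x, |g i x| ≤ C) →
      Integrable (fun η : ProbabilityMeasure X => ∏ i, ∫ x, g i x ∂(η : Measure X)) 𝒟 ∧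
      ∫ η : ProbabilityMeasure X, ∏ i, ∫ x, g i x ∂(η : Measure X) ∂𝒟 =
        (1 / (n : ℝ)) * ∑ ξ : Finset (Fin n) with ξ.card < n,
          (n.choose ξ.card : ℝ)⁻¹ *
            (∫ η : ProbabilityMeasure X, ∏ i ∈ ξ, ∫ x, g i x ∂(η : Measure X) ∂𝒟) *
            ∫ x, ∏ j ∈ ξᶜ, g j x ∂σ := by
    intro n hn g hg hb
    choose C hC using hb
    have hn0 : (n : ℝ) ≠ 0 := Nat.cast_ne_zero.2 (by omega)
    refine ⟨Integrable.of_bound (Finset.measurable_fun_prod _ fun i _ =>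
      measurable_integral_probabilityMeasure (hg i)).aestronglyMeasurable (∏ i, C i)
      (Filter.Eventually.of_forall fun η => ?_), ?_⟩
    · rw [Real.norm_eq_abs, Finset.abs_prod]
      exact Finset.prod_le_prod (fun i _ => abs_nonneg _) fun i _ =>
        abs_integral_probabilityMeasure_le (hC i) _
    · have h := mixedMoment_recursion h𝒟 hg (C := ∑ i, |C i|)
        (fun i x => (hC i x).trans ((le_abs_self _).trans
          (Finset.single_le_sum (f := fun i => |C i|) (fun i _ => abs_nonneg _)
            (Finset.mem_univ i)))) (Finset.sum_nonneg fun i _ => abs_nonneg _)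
      simp only [mixedMoment_eq, ← mul_assoc] at h
      rw [h]
      simp [hn0]
  refine ⟨main, fun n hn g hg ⟨C, hC⟩ => ?_⟩
  have h := (main n hn (fun _ => g) (fun _ => hg) fun _ => ⟨C, hC⟩).2
  simp only [Finset.prod_const, Finset.card_univ, Fintype.card_fin, Finset.card_compl] at h
  rw [h]
  congr 1
  -- The summand depends on `ξ` only through its size, and there are `n.choose i` sets of size `i`.
  have hcount := Finset.sum_powerset_apply_card (fun i => if i < n then (n.choose i : ℝ)⁻¹ *
    (∫ η : ProbabilityMeasure X, (∫ x, g x ∂(η : Measure X)) ^ i ∂𝒟) *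
      ∫ x, g x ^ (n - i) ∂σ else 0) (x := (Finset.univ : Finset (Fin n)))
  rw [Finset.powerset_univ, ← Finset.sum_filter, Finset.card_univ, Fintype.card_fin,
    Finset.sum_range_succ] at hcount
  rw [hcount]
  simp only [lt_irrefl, if_false, smul_zero, add_zero]
  refine Finset.sum_congr rfl fun i hi => ?_
  have hi := Finset.mem_range.1 hi
  have hc : (n.choose i : ℝ) ≠ 0 := Nat.cast_ne_zero.2 (Nat.choose_pos hi.le).ne'
  rw [if_pos hi, nsmul_eq_mul, mul_assoc, mul_inv_cancel_left₀ hc]
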